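/- Let $(V,\omega)$ be a finite-dimensional real symplectic vector space, and fix an inner product on $V$ (equivalently, a basis declared orthonormal), with respect to which transposes $A^T$ are taken. Let $\Gamma$ be a compact Lie group acting linearly on $V$, $x\mapsto\gamma x$, and let $\sigma_1,\sigma_2:\Gamma\to\mathbb{Z}_2=\{\pm1\}$ be group homomorphisms. Suppose the action is $\sigma_1$-semisymplectic, i.e. $\omega(\gamma u,\gamma v)=\sigma_1(\gamma)\,\omega(u,v)$ for all $\gamma\in\Gamma$, $u,v\in V$. For smooth $F:V\to\mathbb{R}$ let $X_F$ be the Hamiltonian vector field defined by $\omega(X_F(x),\cdot)=dF_x$, and put $\{F,G\}(x)=\omega(X_F(x),X_G(x))$. Let $H:V\to\mathbb{R}$ be smooth with $H(0)=0$ and $X_H(0)=0$, and suppose that $X_H$ is $\Gamma_{\sigma_2}$-equivariant: $X_H(\gamma x)=\sigma_2(\gamma)\,\gamma X_H(x)$ for all $\gamma\in\Gamma$, $x\in V$. Let $L=d(X_H)_0$, let $H^2(x)=\tfrac12 d^2H_0(x,x)$, and let $\mathbf{S}=\overline{\{e^{sL^T}:s\in\mathbb{R}\}}\subset GL(V)$.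 Form the semidirect product $\mathbf{S}\rtimes\Gamma$ in which $\gamma$ acts on $\mathbf{S}$ by $B\mapsto B^{\sigma_2(\gamma)}$, and assume that it acts on $V$ by $(B,\gamma)x=B(\gamma x)$, i.e. that $e^{sL^T}\gamma x=\gamma e^{\sigma_2(\gamma)sL^T}x$ for all $s\in\mathbb{R}$, $\gamma\in\Gamma$, $x\in V$ (this is automatic if $\Gamma$ preserves the chosen inner product). Define $\tilde\sigma_j:\mathbf{S}\rtimes\Gamma\to\mathbb{Z}_2$ by $\tilde\sigma_j(B,\gamma)=\sigma_j(\gamma)$, $j=1,2$. Let $\mathcal{P}^k$ be the space of homogeneous polynomial functions $V\to\mathbb{R}$ of degree $k$, let $ad^k_{H^2}:\mathcal{P}^k\to\mathcal{P}^k$ be the linear operator $ad^k_{H^2}(F)=\{F,H^2\}$, and for a group $G$ acting linearly on $V$ and a homomorphism $\chi:G\to\mathbb{Z}_2$ put $\mathcal{P}^k_\chi(G)=\{F\in\mathcal{P}^k: F(gx)=\chi(g)F(x)\ \text{for all } g\in G,\ x\in V\}$. If $\mathbf{S}$ acts symplectically on $(V,\omega)$, i.e. $\omega(Bu,Bv)=\omega(u,v)$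 for all $B\in\mathbf{S}$ and $u,v\in V$, then for every $k\ge 3$ $$\mathcal{P}^k_{\sigma_1\sigma_2}(\Gamma)=ad^k_{H^2}\bigl(\mathcal{P}^k_{\sigma_1}(\Gamma)\bigr)\oplus\mathcal{P}^k_{\tilde\sigma_1\tilde\sigma_2}(\mathbf{S}\rtimes\Gamma).$$ -/

import Mathlib

namespace HamiltonianNormalForm

noncomputable section

/-! ### Polynomial functions -/

section Polynomials

/-- The algebra `𝒫` of polynomial functions `V → ℝ`: the subalgebra of all functions generated by
the linear functionals. -/
def polyFun (V : Type*) [AddCommGroup V] [Module ℝ V] : Subalgebra ℝ (V → ℝ) :=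
  Algebra.adjoin ℝ (Set.range fun φ : Module.Dual ℝ V => (φ : V → ℝ))

/-- The space `𝒫ᵏ` of polynomial functions that are homogeneous of degree `k`. -/
def homPoly (V : Type*) [AddCommGroup V] [Module ℝ V] (k : ℕ) : Submodule ℝ (V → ℝ) where
  carrier := {f | f ∈ polyFun V ∧ ∀ (t : ℝ) (x : V), f (t • x) = t ^ k * f x}
  add_mem' := by
    rintro f g ⟨hf, hf'⟩ ⟨hg, hg'⟩
    refine ⟨add_mem hf hg, fun t x => ?_⟩
    simp only [Pi.add_apply, hf', hg']
    ring
  zero_mem' := ⟨zero_mem _, fun t x => by simp⟩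
  smul_mem' := by
    rintro c f ⟨hf, hf'⟩
    refine ⟨Subalgebra.smul_mem _ hf c, fun t x => ?_⟩
    simp only [Pi.smul_apply, smul_eq_mul, hf']
    ring

end Polynomials

variable {V : Type*} [NormedAddCommGroup V] [InnerProductSpace ℝ V] [FiniteDimensional ℝ V]

/-! ### Linear group actions, semi-invariants, semisymplectic actions -/

/-- For a linear action `ρ` of a group `G` on `V` and a homomorphism `χ : G → {1, -1}`, the space
`𝒫ᵏ_χ(G)` of the `F ∈ 𝒫ᵏ` with `F (g x) = χ(g) F(x)` for all `g ∈ G` and `x ∈ V`. -/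
def semiInvariants {G : Type*} [Group G] (ρ : G →* (V →L[ℝ] V)ˣ) (χ : G →* ℤˣ) (k : ℕ) :
    Submodule ℝ (homPoly V k) where
  carrier := {F | ∀ (g : G) (x : V),
    (F : V → ℝ) ((ρ g : V →L[ℝ] V) x) = ((χ g : ℤ) : ℝ) * (F : V → ℝ) x}
  add_mem' := by
    intro F F' hF hF' g x
    simp only [Submodule.coe_add, Pi.add_apply, hF g x, hF' g x]
    ring
  zero_mem' := fun g x => by simp
  smul_mem' := by
    intro c F hF g x
    simp only [Submodule.coe_smul, Pi.smul_apply, smul_eq_mul, hF g x]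
    ring

/-- The linear action `ρ` of `G` on `(V, ω)` is `χ`-semisymplectic. It is symplectic if this holds
for the trivial homomorphism `χ = 1`. -/
def IsSemisymplectic (ω : LinearMap.BilinForm ℝ V) {G : Type*} [Group G]
    (ρ : G →* (V →L[ℝ] V)ˣ) (χ : G →* ℤˣ) : Prop :=
  ∀ (g : G) (u v : V),
    ω ((ρ g : V →L[ℝ] V) u) ((ρ g : V →L[ℝ] V) v) = ((χ g : ℤ) : ℝ) * ω u v

/-! ### Hamiltonian vector fields and the Poisson bracket -/

/-- The `ω`-Hamiltonian vector field `X_H`: the vector field with `ω(X_H(x), ·) = dH_x`. -/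
def hamVF (ω : LinearMap.BilinForm ℝ V) (hω : ω.Nondegenerate) (H : V → ℝ) (x : V) : V :=
  (ω.toDual hω).symm (fderiv ℝ H x : V →ₗ[ℝ] ℝ)

theorem apply_hamVF (ω : LinearMap.BilinForm ℝ V) (hω : ω.Nondegenerate) (H : V → ℝ) (x v : V) :
    ω (hamVF ω hω H x) v = fderiv ℝ H x v := by
  simp [hamVF, LinearMap.BilinForm.apply_toDual_symm_apply]

/-- The Poisson bracket `{F, G}(x) = ω(X_F(x), X_G(x))`. -/
def poisson (ω : LinearMap.BilinForm ℝ V) (hω : ω.Nondegenerate) (F G : V → ℝ) (x : V) : ℝ :=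
  ω (hamVF ω hω F x) (hamVF ω hω G x)

/-- The quadratic part `H²` of the Taylor expansion of `H` at the origin,
`H²(x) = (1/2) d²H₀(x, x)`. -/
def quadraticPart (H : V → ℝ) : QuadraticForm ℝ V :=
  (1 / 2 : ℝ) • LinearMap.BilinMap.toQuadraticMap
    ((fderiv ℝ (fderiv ℝ H) 0).toLinearMap₁₂ : LinearMap.BilinForm ℝ V)

theorem differentiable_of_mem_polyFun {f : V → ℝ} (hf : f ∈ polyFun V) : Differentiable ℝ f := by
  induction hf using Algebra.adjoin_induction with
  | mem f h =>
    obtain ⟨φ, rfl⟩ := h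
    exact (LinearMap.toContinuousLinearMap φ).differentiable
  | algebraMap r => exact differentiable_const r
  | add f g _ _ hf hg => exact hf.add hg
  | mul f g _ _ hf hg => exact hf.mul hg

theorem fderiv_apply_mem_polyFun (A : V →ₗ[ℝ] V) {f : V → ℝ} (hf : f ∈ polyFun V) :
    (fun x => fderiv ℝ f x (A x)) ∈ polyFun V := by
  induction hf using Algebra.adjoin_induction with
  | mem f h =>
    obtain ⟨φ, rfl⟩ := h
    have : (fun x => fderiv ℝ (φ : V → ℝ) x (A x)) = ((φ ∘ₗ A : Module.Dual ℝ V) : V → ℝ) := by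
      funext x
      have h := (LinearMap.toContinuousLinearMap φ).hasFDerivAt (x := x)
      have h' : fderiv ℝ (φ : V → ℝ) x = LinearMap.toContinuousLinearMap φ := h.fderiv
      rw [h']
      rfl
    rw [this]
    exact Algebra.subset_adjoin ⟨_, rfl⟩
  | algebraMap r =>
    have : (fun x => fderiv ℝ (algebraMap ℝ (V → ℝ) r) x (A x)) = 0 := by
      funext x
      have h : fderiv ℝ (algebraMap ℝ (V → ℝ) r) x = 0 := (hasFDerivAt_const r x).fderiv
      rw [h]
      rfl
    rw [this]
    exact zero_mem _
  | add f g hf' hg' hf hg =>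
    have : (fun x => fderiv ℝ (f + g) x (A x))
        = (fun x => fderiv ℝ f x (A x)) + fun x => fderiv ℝ g x (A x) := by
      funext x
      rw [fderiv_add (differentiable_of_mem_polyFun hf' x) (differentiable_of_mem_polyFun hg' x)]
      rfl
    rw [this]
    exact add_mem hf hg
  | mul f g hf' hg' hf hg =>
    have : (fun x => fderiv ℝ (f * g) x (A x))
        = f * (fun x => fderiv ℝ g x (A x)) + g * fun x => fderiv ℝ f x (A x) := by
      funext x
      rw [fderiv_mul (differentiable_of_mem_polyFun hf' x) (differentiable_of_mem_polyFun hg' x)]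
      rfl
    rw [this]
    exact add_mem (mul_mem hf' hg) (mul_mem hg' hf)

theorem fderiv_apply_mem_homPoly (A : V →ₗ[ℝ] V) {k : ℕ} {f : V → ℝ} (hf : f ∈ homPoly V k) :
    (fun x => fderiv ℝ f x (A x)) ∈ homPoly V k := by
  refine ⟨fderiv_apply_mem_polyFun A hf.1, fun t x => ?_⟩
  have hd := differentiable_of_mem_polyFun hf.1
  have h1 : HasFDerivAt (fun y : V => f (t • y))
      ((fderiv ℝ f (t • x)).comp (t • ContinuousLinearMap.id ℝ V)) x :=
    (hd (t • x)).hasFDerivAt.comp x ((hasFDerivAt_id x).const_smul t)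
  have h2 : HasFDerivAt (fun y : V => f (t • y)) (t ^ k • fderiv ℝ f x) x := by
    have : (fun y : V => f (t • y)) = fun y => t ^ k • f y := by
      funext y
      exact hf.2 t y
    rw [this]
    exact (hd x).hasFDerivAt.const_smul (t ^ k)
  have h3 := congrArg (fun B : V →L[ℝ] ℝ => B (A x)) (h1.unique h2)
  simpa using h3

/-- The Hamiltonian vector field of a quadratic form is linear. -/
theorem exists_hamVF_quadraticForm (ω : LinearMap.BilinForm ℝ V) (hω : ω.Nondegenerate)
    (Q : QuadraticForm ℝ V) : ∃ A : V →ₗ[ℝ] V, ∀ x, hamVF ω hω Q x = A x := by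
  refine ⟨(ω.toDual hω).symm.toLinearMap ∘ₗ QuadraticMap.polarBilin Q, fun x => ?_⟩
  have hQ : HasFDerivAt (Q : V → ℝ) (LinearMap.toContinuousLinearMap
      (QuadraticMap.polarBilin Q x)) x := by
    let B : V →L[ℝ] V →L[ℝ] ℝ := LinearMap.toContinuousLinearMap
      (LinearMap.toContinuousLinearMap.toLinearMap ∘ₗ QuadraticMap.associated Q)
    have hB : ∀ u v, B u v = QuadraticMap.associated Q u v := fun u v => rfl
    have hd := B.hasFDerivAt_of_bilinear (hasFDerivAt_id x) (hasFDerivAt_id x)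
    have e : (Q : V → ℝ) = fun y => B (id y) (id y) := by
      funext y
      exact (QuadraticMap.associated_eq_self_apply ℝ Q y).symm
    rw [e]
    refine hd.congr_fderiv ?_
    ext v
    simp [hB, QuadraticMap.associated_apply, QuadraticMap.polar, add_comm v x]
    ring
  simp only [hamVF, hQ.fderiv]
  rfl

/-- The homological operator `ad^k_Q : 𝒫ᵏ → 𝒫ᵏ`, `ad^k_Q(F) = {F, Q}`, of a quadratic form `Q`. -/
def adOp (ω : LinearMap.BilinForm ℝ V) (hω : ω.Nondegenerate) (Q : QuadraticForm ℝ V) (k : ℕ) :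
    homPoly V k →ₗ[ℝ] homPoly V k where
  toFun F := ⟨poisson ω hω F Q, by
    obtain ⟨A, hA⟩ := exists_hamVF_quadraticForm ω hω Q
    have : poisson ω hω F Q = fun x => fderiv ℝ (F : V → ℝ) x (A x) := by
      funext x
      rw [poisson, apply_hamVF, hA]
    rw [this]
    exact fderiv_apply_mem_homPoly A F.2⟩
  map_add' F G := by
    ext x
    simp only [poisson, apply_hamVF, Submodule.coe_add, Pi.add_apply]
    rw [fderiv_add (differentiable_of_mem_polyFun F.2.1 x)
      (differentiable_of_mem_polyFun G.2.1 x)]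
    rfl
  map_smul' c F := by
    ext x
    simp only [poisson, apply_hamVF, Submodule.coe_smul, Pi.smul_apply, RingHom.id_apply]
    rw [fderiv_const_smul (differentiable_of_mem_polyFun F.2.1 x)]
    rfl

/-! ### The group `S` and the semidirect product `S ⋊ Γ` -/

/-- The transpose of `L` with respect to the inner product of `V`. -/
def transp (L : V →L[ℝ] V) : V →L[ℝ] V :=
  LinearMap.toContinuousLinearMap (LinearMap.adjoint (L : V →ₗ[ℝ] V))

/-- The one-parameter group `s ↦ e^{sA}` in `GL(V)`. -/
def oneParam (A : V →L[ℝ] V) : Multiplicative ℝ →* (V →L[ℝ] V)ˣ :=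
  MonoidHom.toHomUnits
    { toFun := fun s => NormedSpace.exp (s.toAdd • A)
      map_one' := by simp
      map_mul' := by
        intro s t
        have : CompleteSpace (V →L[ℝ] V) := FiniteDimensional.complete ℝ _
        let _ : NormedAlgebra ℚ (V →L[ℝ] V) := NormedAlgebra.restrictScalars ℚ ℝ _
        rw [toAdd_mul, add_smul, NormedSpace.exp_add_of_commute]
        exact ((Commute.refl A).smul_left _).smul_right _ }

/-- The group `S`: the closure in `GL(V)` of the one-parameter group `{e^{sLᵀ} : s ∈ ℝ}`. -/
def groupS (L : V →L[ℝ] V) : Subgroup (V →L[ℝ] V)ˣ :=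
  (oneParam (transp L)).range.topologicalClosure

theorem groupS_mul_comm (L : V →L[ℝ] V) (x y : groupS L) : x * y = y * x :=
  (Subgroup.commGroupTopologicalClosure (oneParam (transp L)).range fun x y => by
    obtain ⟨_, s, rfl⟩ := x
    obtain ⟨_, t, rfl⟩ := y
    ext1
    simp only [Subgroup.coe_mul, ← map_mul, mul_comm]).mul_comm x y

instance instCommGroupGroupS (L : V →L[ℝ] V) : CommGroup (groupS L) :=
  { (groupS L).toGroup with mul_comm := groupS_mul_comm L }

/-- The action of `Γ` on the commutative group `S` by the automorphisms `B ↦ B^{σ(γ)}`, so that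
`γ` sends `e^{sLᵀ}` to `e^{σ(γ)sLᵀ}`. -/
def twist {Γ : Type*} [Group Γ] (σ : Γ →* ℤˣ) (L : V →L[ℝ] V) : Γ →* MulAut (groupS L) where
  toFun γ :=
    { toFun := fun B => B ^ (σ γ : ℤ)
      invFun := fun B => B ^ (σ γ : ℤ)
      left_inv := fun B => by
        change (B ^ (σ γ : ℤ)) ^ (σ γ : ℤ) = B
        rw [← zpow_mul, ← Units.val_mul, Int.units_mul_self, Units.val_one, zpow_one]
      right_inv := fun B => by
        change (B ^ (σ γ : ℤ)) ^ (σ γ : ℤ) = B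
        rw [← zpow_mul, ← Units.val_mul, Int.units_mul_self, Units.val_one, zpow_one]
      map_mul' := fun B C => mul_zpow B C _ }
  map_one' := by
    ext1 B
    simp
  map_mul' γ δ := by
    ext1 B
    change B ^ ((σ (γ * δ) : ℤˣ) : ℤ) = (B ^ (σ δ : ℤ)) ^ (σ γ : ℤ)
    rw [← zpow_mul, map_mul, Units.val_mul, mul_comm]

/-- The identity `e^{sLᵀ} γ = γ e^{σ(γ)sLᵀ}` on `V`, for all `s ∈ ℝ` and `γ ∈ Γ`. It says exactly
that `(B, γ) x = B (γ x)` is an action of the semidirect product `S ⋊ Γ` on `V`. -/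
def SemidirectCompatible {Γ : Type*} [Group Γ] (ρ : Γ →* (V →L[ℝ] V)ˣ) (σ : Γ →* ℤˣ)
    (L : V →L[ℝ] V) : Prop :=
  ∀ (s : ℝ) (γ : Γ), NormedSpace.exp (s • transp L) * (ρ γ : V →L[ℝ] V) =
    (ρ γ : V →L[ℝ] V) * NormedSpace.exp ((((σ γ : ℤ) : ℝ) * s) • transp L)

theorem SemidirectCompatible.conj {Γ : Type*} [Group Γ] {ρ : Γ →* (V →L[ℝ] V)ˣ} {σ : Γ →* ℤˣ}
    {L : V →L[ℝ] V} (h : SemidirectCompatible ρ σ L) (γ : Γ) {B : (V →L[ℝ] V)ˣ}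
    (hB : B ∈ groupS L) : B ^ (σ γ : ℤ) = ρ γ * B * (ρ γ)⁻¹ := by
  have hcl : IsClosed {B : (V →L[ℝ] V)ˣ | B ^ (σ γ : ℤ) = ρ γ * B * (ρ γ)⁻¹} :=
    isClosed_eq (continuous_zpow _) (by fun_prop)
  refine hcl.closure_subset_iff.2 ?_ hB
  rintro _ ⟨s, rfl⟩
  have h1 : ((σ γ : ℤ) : ℝ) * (((σ γ : ℤ) : ℝ) * s.toAdd) = s.toAdd := by
    rw [← mul_assoc, ← Int.cast_mul, ← Units.val_mul, Int.units_mul_self]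
    simp
  have h2 := h (((σ γ : ℤ) : ℝ) * s.toAdd) γ
  rw [h1] at h2
  change oneParam (transp L) s ^ (σ γ : ℤ) = ρ γ * oneParam (transp L) s * (ρ γ)⁻¹
  rw [eq_mul_inv_iff_mul_eq, ← map_zpow]
  ext1
  rw [Units.val_mul, Units.val_mul]
  have h3 : ((oneParam (transp L) (s ^ (σ γ : ℤ)) : (V →L[ℝ] V)ˣ) : V →L[ℝ] V) =
      NormedSpace.exp ((((σ γ : ℤ) : ℝ) * s.toAdd) • transp L) := by
    change NormedSpace.exp ((s ^ (σ γ : ℤ)).toAdd • transp L) = _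
    rw [toAdd_zpow, zsmul_eq_mul]
  rw [h3]
  exact h2

/-- The action `(B, γ) x = B (γ x)` of `S ⋊ Γ` on `V`. -/
def semidirectAction {Γ : Type*} [Group Γ] (ρ : Γ →* (V →L[ℝ] V)ˣ) (σ : Γ →* ℤˣ)
    (L : V →L[ℝ] V) (h : SemidirectCompatible ρ σ L) :
    groupS L ⋊[twist σ L] Γ →* (V →L[ℝ] V)ˣ :=
  SemidirectProduct.lift (groupS L).subtype ρ fun γ => by
    ext1 B
    change ((B ^ (σ γ : ℤ) : groupS L) : (V →L[ℝ] V)ˣ) = ρ γ * B * (ρ γ)⁻¹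
    rw [← h.conj γ B.2]
    exact (groupS L).coe_zpow B _

/-- The homomorphism `τ̃ : S ⋊ Γ → {1, -1}`, `τ̃(B, γ) = τ(γ)`, induced by `τ : Γ → {1, -1}`. -/
def tildeHom {Γ : Type*} [Group Γ] (σ : Γ →* ℤˣ) (L : V →L[ℝ] V) (τ : Γ →* ℤˣ) :
    groupS L ⋊[twist σ L] Γ →* ℤˣ :=
  τ.comp SemidirectProduct.rightHom

end

end HamiltonianNormalForm

open HamiltonianNormalForm

namespace HamiltonianNormalForm

noncomputable section

set_option linter.unusedSectionVars false

/-! ### Linear algebra: complements from a dimension count. -/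

section LinearAlgebra

variable {K W : Type*} [Field K] [AddCommGroup W] [Module K W] [FiniteDimensional K W]

/-! The Hamiltonian field of `H²` is the linearization `L`, so the homological operator is the
derivation `D_L F (x) = dF_x (L x)` (`adOp_quadraticPart`). For the Fischer inner product on `𝒫ᵏ`
the adjoint of `D_L` is `D_{Lᵀ}` (`fischer_vfDeriv`), hence `𝒫ᵏ = range D_L ⊕ ker D_{Lᵀ}`. The
kernel consists of the polynomials constant along the flow `e^{sLᵀ}`, that is, of the `S`-invariants
(`mem_ker_vfDeriv_iff`).

It remains to restrict this splitting to semi-invariants. Substitution by `γ` commutes with both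
`D_L` and `D_{Lᵀ}` up to the sign `σ₂(γ)`, so it preserves all ranges and kernels involved. If `F =
D_L P + Q`, uniqueness of the components makes `D_L P` and `Q` semi-invariant. Choosing `P` in
`range D_{Lᵀ}`, a complement of `ker D_L`, makes `P` unique as well, hence `σ₁`-semi-invariant
(`exists_semiInvariant_decomposition`). -/

theorem isCompl_range_ker_of_disjoint {D D' : W →ₗ[K] W}
    (h : Disjoint (LinearMap.range D) (LinearMap.ker D'))
    (h' : Disjoint (LinearMap.range D') (LinearMap.ker D)) :
    IsCompl (LinearMap.range D) (LinearMap.ker D') := by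
  refine ⟨h, codisjoint_iff.2 (Submodule.eq_top_of_disjoint _ _ ?_ h)⟩
  -- Rank-nullity for both maps makes the two disjointness inequalities sum to an equality, so each
  -- is sharp.
  have e := LinearMap.finrank_range_add_finrank_ker D
  have e' := LinearMap.finrank_range_add_finrank_ker D'
  have i := Submodule.finrank_add_finrank_le_of_disjoint h
  have i' := Submodule.finrank_add_finrank_le_of_disjoint h'
  omega

end LinearAlgebra

variable {V : Type*} [NormedAddCommGroup V] [InnerProductSpace ℝ V] [FiniteDimensional ℝ V]

/-! ### Calculus of polynomial functions -/

theorem contDiff_of_mem_polyFun {f : V → ℝ} (hf : f ∈ polyFun V) {n : WithTop ℕ∞} :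
    ContDiff ℝ n f := by
  induction hf using Algebra.adjoin_induction with
  | mem f h =>
    obtain ⟨φ, rfl⟩ := h
    exact (LinearMap.toContinuousLinearMap φ).contDiff
  | algebraMap r => exact contDiff_const
  | add f g _ _ hf hg => exact hf.add hg
  | mul f g _ _ hf hg => exact hf.mul hg

theorem comp_mem_polyFun (A : V →ₗ[ℝ] V) {f : V → ℝ} (hf : f ∈ polyFun V) :
    (fun x => f (A x)) ∈ polyFun V := by
  induction hf using Algebra.adjoin_induction with
  | mem f h =>
    obtain ⟨φ, rfl⟩ := h
    exact Algebra.subset_adjoin ⟨φ ∘ₗ A, rfl⟩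
  | algebraMap r => exact Subalgebra.algebraMap_mem _ r
  | add f g _ _ hf hg => exact add_mem hf hg
  | mul f g _ _ hf hg => exact mul_mem hf hg

theorem fderiv_const_apply_mem_polyFun (v : V) {f : V → ℝ} (hf : f ∈ polyFun V) :
    (fun x => fderiv ℝ f x v) ∈ polyFun V := by
  induction hf using Algebra.adjoin_induction with
  | mem f h =>
    obtain ⟨φ, rfl⟩ := h
    have : (fun x => fderiv ℝ (φ : V → ℝ) x v) = algebraMap ℝ (V → ℝ) (φ v) := by
      funext x
      have h' : fderiv ℝ (φ : V → ℝ) x = LinearMap.toContinuousLinearMap φ :=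
        (LinearMap.toContinuousLinearMap φ).hasFDerivAt.fderiv
      rw [h']
      rfl
    rw [this]
    exact Subalgebra.algebraMap_mem _ _
  | algebraMap r =>
    have : (fun x => fderiv ℝ (algebraMap ℝ (V → ℝ) r) x v) = 0 := by
      funext x
      have h : fderiv ℝ (algebraMap ℝ (V → ℝ) r) x = 0 := (hasFDerivAt_const r x).fderiv
      rw [h]
      rfl
    rw [this]
    exact zero_mem _
  | add f g hf' hg' hf hg =>
    have : (fun x => fderiv ℝ (f + g) x v)
        = (fun x => fderiv ℝ f x v) + fun x => fderiv ℝ g x v := by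
      funext x
      rw [fderiv_add (differentiable_of_mem_polyFun hf' x) (differentiable_of_mem_polyFun hg' x)]
      rfl
    rw [this]
    exact add_mem hf hg
  | mul f g hf' hg' hf hg =>
    have : (fun x => fderiv ℝ (f * g) x v)
        = f * (fun x => fderiv ℝ g x v) + g * fun x => fderiv ℝ f x v := by
      funext x
      rw [fderiv_mul (differentiable_of_mem_polyFun hf' x) (differentiable_of_mem_polyFun hg' x)]
      rfl
    rw [this]
    exact add_mem (mul_mem hf' hg) (mul_mem hg' hf)

theorem fderiv_const_apply_mem_homPoly (v : V) {k : ℕ} {f : V → ℝ} (hf : f ∈ homPoly V (k + 1)) :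
    (fun x => fderiv ℝ f x v) ∈ homPoly V k := by
  have hmem := fderiv_const_apply_mem_polyFun v hf.1
  refine ⟨hmem, fun t x => ?_⟩
  have hd := differentiable_of_mem_polyFun hf.1
  have hc : Continuous fun x => fderiv ℝ f x v := (differentiable_of_mem_polyFun hmem).continuous
  have key : (fun t : ℝ => fderiv ℝ f (t • x) v) = fun t => t ^ k * fderiv ℝ f x v := by
    -- The chain rule gives the identity multiplied by `t`; cancelling needs `t ≠ 0`, and continuity
    -- recovers `t = 0`.
    refine Continuous.ext_on (dense_compl_singleton (0 : ℝ)) (by fun_prop) (by fun_prop) ?_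
    intro t ht
    have h1 : HasFDerivAt (fun y : V => f (t • y))
        ((fderiv ℝ f (t • x)).comp (t • ContinuousLinearMap.id ℝ V)) x :=
      (hd (t • x)).hasFDerivAt.comp x ((hasFDerivAt_id x).const_smul t)
    have h2 : HasFDerivAt (fun y : V => f (t • y)) (t ^ (k + 1) • fderiv ℝ f x) x := by
      have : (fun y : V => f (t • y)) = fun y => t ^ (k + 1) • f y := by
        funext y
        exact hf.2 t y
      rw [this]
      exact (hd x).hasFDerivAt.const_smul (t ^ (k + 1))
    have h3 := congrArg (fun B : V →L[ℝ] ℝ => B v) (h1.unique h2)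
    simp only [ContinuousLinearMap.comp_apply, smul_apply,
      ContinuousLinearMap.id_apply, map_smul, smul_eq_mul] at h3
    refine mul_left_cancel₀ (show t ≠ 0 from ht) ?_
    change t * fderiv ℝ f (t • x) v = t * (t ^ k * fderiv ℝ f x v)
    rw [h3]
    ring
  exact congrFun key t

theorem homPoly_differentiable {k : ℕ} (F : homPoly V k) : Differentiable ℝ (F : V → ℝ) :=
  differentiable_of_mem_polyFun F.2.1

/-- The directional derivative `∂_v : 𝒫ᵏ⁺¹ → 𝒫ᵏ`. -/
def dirDeriv (k : ℕ) : V →ₗ[ℝ] homPoly V (k + 1) →ₗ[ℝ] homPoly V k :=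
  LinearMap.mk₂ ℝ (fun v F => ⟨fun x => fderiv ℝ (F : V → ℝ) x v,
      fderiv_const_apply_mem_homPoly v F.2⟩)
    (fun v w F => by ext x; simp)
    (fun c v F => by ext x; simp)
    (fun v F G => by
      ext x
      simp only [Submodule.coe_add, Pi.add_apply]
      rw [fderiv_add (homPoly_differentiable F x) (homPoly_differentiable G x)]
      rfl)
    (fun c v F => by
      ext x
      simp only [Submodule.coe_smul, Pi.smul_apply]
      rw [fderiv_const_smul (homPoly_differentiable F x)]
      rfl)

theorem dirDeriv_apply {k : ℕ} (v : V) (F : homPoly V (k + 1)) (x : V) :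
    (dirDeriv k v F : V → ℝ) x = fderiv ℝ (F : V → ℝ) x v := rfl

/-- The derivation `F ↦ (x ↦ dF_x (A x))` of `𝒫ᵏ` along the linear vector field `A`. -/
def vfDeriv (A : V →ₗ[ℝ] V) (k : ℕ) : homPoly V k →ₗ[ℝ] homPoly V k where
  toFun F := ⟨fun x => fderiv ℝ (F : V → ℝ) x (A x), fderiv_apply_mem_homPoly A F.2⟩
  map_add' F G := by
    ext x
    simp only [Submodule.coe_add, Pi.add_apply]
    rw [fderiv_add (homPoly_differentiable F x) (homPoly_differentiable G x)]
    rfl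
  map_smul' c F := by
    ext x
    simp only [Submodule.coe_smul, Pi.smul_apply, RingHom.id_apply]
    rw [fderiv_const_smul (homPoly_differentiable F x)]
    rfl

theorem vfDeriv_apply (A : V →ₗ[ℝ] V) {k : ℕ} (F : homPoly V k) (x : V) :
    (vfDeriv A k F : V → ℝ) x = fderiv ℝ (F : V → ℝ) x (A x) := rfl

theorem homPoly_zero_apply (F : homPoly V 0) (x : V) : (F : V → ℝ) x = (F : V → ℝ) 0 := by
  simpa using (F.2.2 0 x).symm

theorem homPoly_succ_apply_zero {k : ℕ} (F : homPoly V (k + 1)) : (F : V → ℝ) 0 = 0 := by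
  simpa using F.2.2 0 0

theorem vfDeriv_zero (A : V →ₗ[ℝ] V) (F : homPoly V 0) : vfDeriv A 0 F = 0 := by
  ext x
  have : (F : V → ℝ) = fun _ => (F : V → ℝ) 0 := funext (homPoly_zero_apply F)
  rw [vfDeriv_apply, this]
  simp

/-- Product rule and symmetry of the second derivative. This commutator `[∂_v, D_A] = ∂_{Av}` drives
the induction on degree in `fischer_vfDeriv`. -/
theorem dirDeriv_vfDeriv (A : V →ₗ[ℝ] V) {k : ℕ} (v : V) (F : homPoly V (k + 1)) :
    dirDeriv k v (vfDeriv A (k + 1) F) = vfDeriv A k (dirDeriv k v F) + dirDeriv k (A v) F := by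
  ext x
  have hF : ContDiff ℝ 2 (F : V → ℝ) := contDiff_of_mem_polyFun F.2.1
  have hd : DifferentiableAt ℝ (fderiv ℝ (F : V → ℝ)) x :=
    (hF.fderiv_right (m := 1) (by norm_num)).differentiable (by norm_num) x
  have h1 : HasFDerivAt (fun y => fderiv ℝ (F : V → ℝ) y (A y)) _ x :=
    hd.hasFDerivAt.clm_apply (LinearMap.toContinuousLinearMap A).hasFDerivAt
  have h2 : HasFDerivAt (fun y => fderiv ℝ (F : V → ℝ) y v) _ x :=
    hd.hasFDerivAt.clm_apply (hasFDerivAt_const v x)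
  have hs : IsSymmSndFDerivAt ℝ (F : V → ℝ) x :=
    hF.contDiffAt.isSymmSndFDerivAt (by simp)
  change fderiv ℝ (fun y => fderiv ℝ (F : V → ℝ) y (A y)) x v =
    fderiv ℝ (fun y => fderiv ℝ (F : V → ℝ) y v) x (A x) + fderiv ℝ (F : V → ℝ) x (A v)
  rw [h1.fderiv, h2.fderiv]
  simp [hs.eq v (A x), add_comm]

/-- Such an `F` is constant, and positive degree forces the value `0` at the origin. -/
theorem eq_zero_of_dirDeriv_eq_zero {k : ℕ} {F : homPoly V (k + 1)}
    (h : ∀ i, dirDeriv k (stdOrthonormalBasis ℝ V i) F = 0) : F = 0 := by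
  have h0 : ∀ v, dirDeriv k v F = 0 := by
    intro v
    have : (dirDeriv k).flip F = 0 := (stdOrthonormalBasis ℝ V).toBasis.ext fun i => by
      simpa using h i
    exact LinearMap.congr_fun this v
  ext x
  have hc := is_const_of_fderiv_eq_zero (homPoly_differentiable F) (fun y => by
    ext v
    exact congrArg (fun G : homPoly V k => (G : V → ℝ) y) (h0 v)) x 0
  rw [hc, homPoly_succ_apply_zero]
  rfl

/-- The partial derivatives embed `𝒫ᵏ⁺¹` into a finite power of `𝒫ᵏ`. -/
instance finiteDimensional_homPoly (k : ℕ) : FiniteDimensional ℝ (homPoly V k) := by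
  induction k with
  | zero =>
    refine FiniteDimensional.of_injective
      ((LinearMap.proj (0 : V) : (V → ℝ) →ₗ[ℝ] ℝ) ∘ₗ (homPoly V 0).subtype) ?_
    intro F G h
    ext x
    rw [homPoly_zero_apply F, homPoly_zero_apply G]
    exact h
  | succ k ih =>
    refine FiniteDimensional.of_injective
      (LinearMap.pi fun i => dirDeriv k (stdOrthonormalBasis ℝ V i)) ?_
    rw [← LinearMap.ker_eq_bot, LinearMap.ker_eq_bot']
    exact fun F hF => eq_zero_of_dirDeriv_eq_zero fun i => congrFun hF i

/-! ### The Fischer inner product -/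

/-- The Fischer inner product on `𝒫ᵏ`, with
`⟨F, G⟩ = ∑ ∂_{i₁} ⋯ ∂_{iₖ} F · ∂_{i₁} ⋯ ∂_{iₖ} G` in orthonormal coordinates. -/
def fischer : (k : ℕ) → homPoly V k →ₗ[ℝ] homPoly V k →ₗ[ℝ] ℝ
  | 0 => (LinearMap.mul ℝ ℝ).compl₁₂
      ((LinearMap.proj (0 : V) : (V → ℝ) →ₗ[ℝ] ℝ) ∘ₗ (homPoly V 0).subtype)
      ((LinearMap.proj (0 : V) : (V → ℝ) →ₗ[ℝ] ℝ) ∘ₗ (homPoly V 0).subtype)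
  | k + 1 => ∑ i, (fischer k).compl₁₂ (dirDeriv k (stdOrthonormalBasis ℝ V i))
      (dirDeriv k (stdOrthonormalBasis ℝ V i))

theorem fischer_zero (F G : homPoly V 0) :
    fischer 0 F G = (F : V → ℝ) 0 * (G : V → ℝ) 0 := rfl

theorem fischer_succ {k : ℕ} (F G : homPoly V (k + 1)) :
    fischer (k + 1) F G = ∑ i, fischer k (dirDeriv k (stdOrthonormalBasis ℝ V i) F)
      (dirDeriv k (stdOrthonormalBasis ℝ V i) G) := by
  simp [fischer, LinearMap.sum_apply]

theorem fischer_self_nonneg {k : ℕ} (F : homPoly V k) : 0 ≤ fischer k F F := by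
  induction k with
  | zero => exact mul_self_nonneg _
  | succ k ih =>
    rw [fischer_succ]
    exact Finset.sum_nonneg fun i _ => ih _

theorem eq_zero_of_fischer_self {k : ℕ} {F : homPoly V k} (h : fischer k F F = 0) : F = 0 := by
  induction k with
  | zero =>
    ext x
    rw [homPoly_zero_apply]
    exact mul_self_eq_zero.1 h
  | succ k ih =>
    rw [fischer_succ, Finset.sum_eq_zero_iff_of_nonneg fun i _ => fischer_self_nonneg _] at h
    exact eq_zero_of_dirDeriv_eq_zero fun i => ih (h i (Finset.mem_univ i))

/-- Expanded in the orthonormal basis, both sides are the same double sum weighted by the matrix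
entries of `A`. -/
theorem sum_fischer_dirDeriv_adjoint (A : V →ₗ[ℝ] V) {k : ℕ} (F G : homPoly V (k + 1)) :
    ∑ i, fischer k (dirDeriv k (A (stdOrthonormalBasis ℝ V i)) F)
        (dirDeriv k (stdOrthonormalBasis ℝ V i) G) =
      ∑ i, fischer k (dirDeriv k (stdOrthonormalBasis ℝ V i) F)
        (dirDeriv k (LinearMap.adjoint A (stdOrthonormalBasis ℝ V i)) G) := by
  set b := stdOrthonormalBasis ℝ V
  have h1 : ∀ i, fischer k (dirDeriv k (A (b i)) F) (dirDeriv k (b i) G) =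
      ∑ j, inner ℝ (b j) (A (b i)) * fischer k (dirDeriv k (b j) F) (dirDeriv k (b i) G) := by
    intro i
    conv_lhs => rw [← b.sum_repr' (A (b i))]
    simp [LinearMap.sum_apply]
  have h2 : ∀ i, fischer k (dirDeriv k (b i) F) (dirDeriv k (LinearMap.adjoint A (b i)) G) =
      ∑ j, inner ℝ (b i) (A (b j)) * fischer k (dirDeriv k (b i) F) (dirDeriv k (b j) G) := by
    intro i
    conv_lhs => rw [← b.sum_repr' (LinearMap.adjoint A (b i))]
    simp [LinearMap.sum_apply, LinearMap.adjoint_inner_right, real_inner_comm]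
  simp_rw [h1, h2]
  exact Finset.sum_comm

theorem fischer_vfDeriv (A : V →ₗ[ℝ] V) {k : ℕ} (F G : homPoly V k) :
    fischer k (vfDeriv A k F) G = fischer k F (vfDeriv (LinearMap.adjoint A) k G) := by
  induction k with
  | zero => simp [vfDeriv_zero]
  | succ k ih =>
    simp only [fischer_succ, dirDeriv_vfDeriv, map_add, LinearMap.add_apply,
      Finset.sum_add_distrib, ih, sum_fischer_dirDeriv_adjoint]

/-- If `D_{Aᵀ} D_A F = 0`, then `⟨D_A F, D_A F⟩ = ⟨F, D_{Aᵀ} D_A F⟩ = 0`, and the Fischer form is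
definite. -/
theorem disjoint_range_ker_vfDeriv_adjoint (A : V →ₗ[ℝ] V) (k : ℕ) :
    Disjoint (LinearMap.range (vfDeriv A k))
      (LinearMap.ker (vfDeriv (LinearMap.adjoint A) k)) := by
  rw [Submodule.disjoint_def]
  rintro _ ⟨F, rfl⟩ h
  apply eq_zero_of_fischer_self
  rw [fischer_vfDeriv, LinearMap.mem_ker.1 h, map_zero]

theorem isCompl_range_ker_vfDeriv_adjoint (A : V →ₗ[ℝ] V) (k : ℕ) :
    IsCompl (LinearMap.range (vfDeriv A k))
      (LinearMap.ker (vfDeriv (LinearMap.adjoint A) k)) :=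
  isCompl_range_ker_of_disjoint (disjoint_range_ker_vfDeriv_adjoint A k) (by
    simpa using disjoint_range_ker_vfDeriv_adjoint (LinearMap.adjoint A) k)

/-! ### Linear substitutions -/

/-- The substitution operator `F ↦ F ∘ B` on `𝒫ᵏ`. -/
def substOp (B : V →ₗ[ℝ] V) (k : ℕ) : homPoly V k →ₗ[ℝ] homPoly V k where
  toFun F := ⟨fun x => (F : V → ℝ) (B x), comp_mem_polyFun B F.2.1, fun t x => by
    change (F : V → ℝ) (B (t • x)) = _
    rw [map_smul, F.2.2]⟩
  map_add' F G := rfl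
  map_smul' c F := rfl

theorem substOp_apply (B : V →ₗ[ℝ] V) {k : ℕ} (F : homPoly V k) (x : V) :
    (substOp B k F : V → ℝ) x = (F : V → ℝ) (B x) := rfl

/-- Chain rule. It is used with `B = ρ γ`, `c = σ₂(γ)`, and `A` either `L` or `Lᵀ`. -/
theorem substOp_vfDeriv {A B : V →ₗ[ℝ] V} {c : ℝ} (h : ∀ x, A (B x) = c • B (A x)) {k : ℕ}
    (F : homPoly V k) : substOp B k (vfDeriv A k F) = c • vfDeriv A k (substOp B k F) := by
  ext x
  have h1 : HasFDerivAt (fun y => (F : V → ℝ) (B y))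
      ((fderiv ℝ (F : V → ℝ) (B x)).comp (LinearMap.toContinuousLinearMap B)) x :=
    (homPoly_differentiable F (B x)).hasFDerivAt.comp x
      (LinearMap.toContinuousLinearMap B).hasFDerivAt
  change fderiv ℝ (F : V → ℝ) (B x) (A (B x)) = c * fderiv ℝ (fun y => (F : V → ℝ) (B y)) x (A x)
  rw [h1.fderiv, h]
  simp

theorem mem_semiInvariants_iff {G : Type*} [Group G] {ρ : G →* (V →L[ℝ] V)ˣ} {χ : G →* ℤˣ}
    {k : ℕ} {F : homPoly V k} : F ∈ semiInvariants ρ χ k ↔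
      ∀ g, substOp (ρ g : V →L[ℝ] V) k F = ((χ g : ℤ) : ℝ) • F := by
  refine forall_congr' fun g => ⟨fun h => ?_, fun h x => ?_⟩
  · ext x
    exact h x
  · exact congrArg (fun F : homPoly V k => (F : V → ℝ) x) h

/-! ### Invariants of the one-parameter group -/

theorem hasDerivAt_comp_oneParam (A : V →L[ℝ] V) {k : ℕ} (F : homPoly V k) (x : V) (s : ℝ) :
    HasDerivAt (fun s : ℝ => (F : V → ℝ) (NormedSpace.exp (s • A) x))
      ((vfDeriv A k F : V → ℝ) (NormedSpace.exp (s • A) x)) s := by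
  have : CompleteSpace (V →L[ℝ] V) := FiniteDimensional.complete ℝ _
  have h1 := (hasDerivAt_exp_smul_const' (𝕂 := ℝ) A s).clm_apply (hasDerivAt_const s x)
  have h2 := (homPoly_differentiable F (NormedSpace.exp (s • A) x)).hasFDerivAt.comp_hasDerivAt s h1
  refine h2.congr_deriv ?_
  simp [vfDeriv_apply]

theorem mem_ker_vfDeriv_iff {L : V →L[ℝ] V} {k : ℕ} {F : homPoly V k} :
    F ∈ LinearMap.ker (vfDeriv (LinearMap.adjoint (L : V →ₗ[ℝ] V)) k) ↔
      ∀ B ∈ groupS L, ∀ x, (F : V → ℝ) ((B : V →L[ℝ] V) x) = (F : V → ℝ) x := by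
  have hT : ((transp L : V →L[ℝ] V) : V →ₗ[ℝ] V) = LinearMap.adjoint (L : V →ₗ[ℝ] V) := rfl
  rw [← hT, LinearMap.mem_ker]
  constructor
  · intro h B hB x
    have hcl : IsClosed {B : (V →L[ℝ] V)ˣ | (F : V → ℝ) ((B : V →L[ℝ] V) x) = (F : V → ℝ) x} :=
      isClosed_eq ((homPoly_differentiable F).continuous.comp
        (((ContinuousLinearMap.apply ℝ V x).continuous).comp Units.continuous_val))
        continuous_const
    -- Fixing the value of `F` at `x` is a closed condition on `B`, so the one-parameter group
    -- suffices.
    refine hcl.closure_subset_iff.2 ?_ hB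
    rintro _ ⟨s, rfl⟩
    have hd := hasDerivAt_comp_oneParam (transp L) F x
    have hc := is_const_of_deriv_eq_zero (fun s => (hd s).differentiableAt)
      (fun s => by rw [(hd s).deriv, h]; rfl) s.toAdd 0
    simp only [zero_smul, NormedSpace.exp_zero] at hc
    exact hc
  · intro h
    ext x
    have hd := hasDerivAt_comp_oneParam (transp L) F x 0
    have hc : (fun s : ℝ => (F : V → ℝ) (NormedSpace.exp (s • transp L) x)) =
        fun _ => (F : V → ℝ) x := by
      funext s
      exact h (oneParam (transp L) (Multiplicative.ofAdd s))
        (Subgroup.le_topologicalClosure _ ⟨_, rfl⟩) x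
    rw [hc] at hd
    simpa using hd.unique (hasDerivAt_const _ _)

/-- The two factors generate the semidirect product, and the characters `τ̃` are trivial on `S`. -/
theorem mem_semiInvariants_semidirectAction_iff {Γ : Type*} [Group Γ] {ρ : Γ →* (V →L[ℝ] V)ˣ}
    {σ : Γ →* ℤˣ} {L : V →L[ℝ] V} (h : SemidirectCompatible ρ σ L) (τ τ' : Γ →* ℤˣ) {k : ℕ}
    {F : homPoly V k} :
    F ∈ semiInvariants (semidirectAction ρ σ L h) (tildeHom σ L τ * tildeHom σ L τ') k ↔
      F ∈ LinearMap.ker (vfDeriv (LinearMap.adjoint (L : V →ₗ[ℝ] V)) k) ∧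
        F ∈ semiInvariants ρ (τ * τ') k := by
  rw [mem_ker_vfDeriv_iff]
  constructor
  · intro hF
    refine ⟨fun B hB x => ?_, fun γ x => ?_⟩
    · simpa [semidirectAction, tildeHom] using hF (SemidirectProduct.inl ⟨B, hB⟩) x
    · simpa [semidirectAction, tildeHom] using hF (SemidirectProduct.inr γ) x
  · rintro ⟨hS, hΓ⟩ g x
    have e : ((semidirectAction ρ σ L h g : (V →L[ℝ] V)ˣ) : V →L[ℝ] V) x =
      ((g.left : (V →L[ℝ] V)ˣ) : V →L[ℝ] V) ((ρ g.right : V →L[ℝ] V) x) := rfl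
    rw [e, hS _ g.left.2]
    exact hΓ g.right x

/-- Differentiate the compatibility identity at `s = 0`. Since `Γ` need not be orthogonal, this
cannot be read off by transposing the equivariance of `L`. -/
theorem SemidirectCompatible.transp_apply {Γ : Type*} [Group Γ] {ρ : Γ →* (V →L[ℝ] V)ˣ}
    {σ : Γ →* ℤˣ} {L : V →L[ℝ] V} (h : SemidirectCompatible ρ σ L) (γ : Γ) (x : V) :
    LinearMap.adjoint (L : V →ₗ[ℝ] V) ((ρ γ : V →L[ℝ] V) x) =
      ((σ γ : ℤ) : ℝ) • (ρ γ : V →L[ℝ] V) (LinearMap.adjoint (L : V →ₗ[ℝ] V) x) := by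
  have : CompleteSpace (V →L[ℝ] V) := FiniteDimensional.complete ℝ _
  have h1 := (hasDerivAt_exp_smul_const' (𝕂 := ℝ) (transp L) (0 : ℝ)).mul_const
    (ρ γ : V →L[ℝ] V)
  have h2 := (hasDerivAt_exp_smul_const' (𝕂 := ℝ) (((σ γ : ℤ) : ℝ) • transp L) (0 : ℝ)).const_mul
    (ρ γ : V →L[ℝ] V)
  have e : (fun s : ℝ => NormedSpace.exp (s • transp L) * (ρ γ : V →L[ℝ] V)) =
      fun s : ℝ => (ρ γ : V →L[ℝ] V) * NormedSpace.exp (s • ((σ γ : ℤ) : ℝ) • transp L) := by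
    funext s
    rw [h s γ, smul_smul, mul_comm s]
  rw [e] at h1
  have h3 := congrArg (fun B : V →L[ℝ] V => B x) (h1.unique h2)
  simp only [zero_smul, NormedSpace.exp_zero, mul_one, mul_smul_comm] at h3
  exact h3

/-! ### The linearization of a Hamiltonian vector field -/

/-- The field is a fixed linear map `Φ`, the inverse of `v ↦ ω(v, ·)`, applied to `dH`. -/
theorem hasFDerivAt_hamVF (ω : LinearMap.BilinForm ℝ V) (hω : ω.Nondegenerate) {H : V → ℝ}
    (hH : ContDiff ℝ 2 H) (x : V) :
    HasFDerivAt (hamVF ω hω H) (fderiv ℝ (hamVF ω hω H) x) x ∧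
      ∀ u v, ω (fderiv ℝ (hamVF ω hω H) x u) v = fderiv ℝ (fderiv ℝ H) x u v := by
  let Φ : (V →L[ℝ] ℝ) →L[ℝ] V := LinearMap.toContinuousLinearMap
    ((ω.toDual hω).symm.toLinearMap ∘ₗ LinearMap.toContinuousLinearMap.symm.toLinearMap)
  have hd : DifferentiableAt ℝ (fderiv ℝ H) x :=
    (hH.fderiv_right (m := 1) (by norm_num)).differentiable (by norm_num) x
  have h : HasFDerivAt (hamVF ω hω H) (Φ.comp (fderiv ℝ (fderiv ℝ H) x)) x :=
    Φ.hasFDerivAt.comp x hd.hasFDerivAt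
  refine ⟨h.differentiableAt.hasFDerivAt, fun u v => ?_⟩
  rw [h.fderiv]
  exact LinearMap.BilinForm.apply_toDual_symm_apply (hB := hω) ..

theorem fderiv_quadraticPart {H : V → ℝ} (hH : ContDiff ℝ 2 H) (x v : V) :
    fderiv ℝ (quadraticPart H) x v = fderiv ℝ (fderiv ℝ H) 0 x v := by
  set B := fderiv ℝ (fderiv ℝ H) 0
  have hs : IsSymmSndFDerivAt ℝ H 0 := hH.contDiffAt.isSymmSndFDerivAt (by simp)
  have hd : HasFDerivAt (fun y => (1 / 2 : ℝ) • B y y) _ x :=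
    (B.hasFDerivAt_of_bilinear (hasFDerivAt_id x) (hasFDerivAt_id x)).const_smul (1 / 2 : ℝ)
  have e : (quadraticPart H : V → ℝ) = fun y => (1 / 2 : ℝ) • B y y := rfl
  rw [e, hd.fderiv]
  have := hs.eq v x
  simp only [one_div, smul_apply, add_apply, smul_eq_mul,
    ContinuousLinearMap.precompR_apply, ContinuousLinearMap.precompL_apply, id,
    ContinuousLinearMap.id_apply]
  change 2⁻¹ * (B x v + B v x) = B x v
  rw [show B v x = B x v from this]
  ring

/-- Paired with any `v` under `ω`, both `X_{H²}(x)` and `d(X_H)₀ x` give `d²H₀(x, v)`; nondegeneracy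
identifies them. -/
theorem adOp_quadraticPart (ω : LinearMap.BilinForm ℝ V) (hω : ω.Nondegenerate) {H : V → ℝ}
    (hH : ContDiff ℝ 2 H) (k : ℕ) :
    adOp ω hω (quadraticPart H) k =
      vfDeriv (fderiv ℝ (hamVF ω hω H) 0 : V →L[ℝ] V) k := by
  have key : ∀ x, hamVF ω hω (quadraticPart H) x = fderiv ℝ (hamVF ω hω H) 0 x := by
    intro x
    apply (ω.toDual hω).injective
    ext v
    change ω _ v = ω _ v
    rw [apply_hamVF, fderiv_quadraticPart hH, (hasFDerivAt_hamVF ω hω hH 0).2]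
  ext F x
  change ω (hamVF ω hω F x) (hamVF ω hω (quadraticPart H) x) = _
  rw [apply_hamVF, key]
  rfl

theorem fderiv_zero_equivariant {X : V → V} {L B : V →L[ℝ] V} (hX : HasFDerivAt X L 0) {c : ℝ}
    (h : ∀ x, X (B x) = c • B (X x)) (x : V) : L (B x) = c • B (L x) := by
  have hX' : HasFDerivAt X L (B 0) := by simpa using hX
  have h1 : HasFDerivAt (fun x => X (B x)) (L.comp B) 0 := hX'.comp 0 B.hasFDerivAt
  have h2 : HasFDerivAt (fun x => c • B (X x)) (c • B.comp L) 0 :=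
    (B.hasFDerivAt.comp 0 hX).const_smul c
  simp_rw [h] at h1
  simpa using congrArg (fun A : V →L[ℝ] V => A x) (h1.unique h2)

/-! ### The equivariant splitting

The complement `range (vfDeriv Aᵀ)` of `ker (vfDeriv A)` is itself stable under the group, so no
averaging over the group is needed, and neither compactness nor the symplecticity of the actions
enters. -/

theorem intCast_units_mul_self (u : ℤˣ) : ((u : ℤ) : ℝ) * ((u : ℤ) : ℝ) = 1 := by
  rw [← Int.cast_mul, ← Units.val_mul, Int.units_mul_self]
  simp

theorem map_vfDeriv_semiInvariants_le {G : Type*} [Group G] {ρ : G →* (V →L[ℝ] V)ˣ}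
    {σ₁ σ₂ : G →* ℤˣ} {A : V →ₗ[ℝ] V}
    (hA : ∀ g x, A ((ρ g : V →L[ℝ] V) x) = ((σ₂ g : ℤ) : ℝ) • (ρ g : V →L[ℝ] V) (A x)) (k : ℕ) :
    Submodule.map (vfDeriv A k) (semiInvariants ρ σ₁ k) ≤ semiInvariants ρ (σ₁ * σ₂) k := by
  rintro _ ⟨F, hF, rfl⟩
  rw [mem_semiInvariants_iff]
  intro g
  rw [substOp_vfDeriv (hA g), mem_semiInvariants_iff.1 hF g, map_smul, smul_smul]
  simp [mul_comm]

theorem exists_semiInvariant_decomposition {G : Type*} [Group G] {ρ : G →* (V →L[ℝ] V)ˣ}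
    {σ₁ σ₂ : G →* ℤˣ} {A : V →ₗ[ℝ] V}
    (hA : ∀ g x, A ((ρ g : V →L[ℝ] V) x) = ((σ₂ g : ℤ) : ℝ) • (ρ g : V →L[ℝ] V) (A x))
    (hA' : ∀ g x, LinearMap.adjoint A ((ρ g : V →L[ℝ] V) x) =
      ((σ₂ g : ℤ) : ℝ) • (ρ g : V →L[ℝ] V) (LinearMap.adjoint A x)) {k : ℕ}
    {F : homPoly V k} (hF : F ∈ semiInvariants ρ (σ₁ * σ₂) k) :
    ∃ P ∈ semiInvariants ρ σ₁ k, ∃ Q ∈ LinearMap.ker (vfDeriv (LinearMap.adjoint A) k),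
      Q ∈ semiInvariants ρ (σ₁ * σ₂) k ∧ vfDeriv A k P + Q = F := by
  have hc := isCompl_range_ker_vfDeriv_adjoint A k
  have hc' : IsCompl (LinearMap.range (vfDeriv (LinearMap.adjoint A) k))
      (LinearMap.ker (vfDeriv A k)) := by
    simpa using isCompl_range_ker_vfDeriv_adjoint (LinearMap.adjoint A) k
  obtain ⟨_, ⟨P₀, rfl⟩, Q, hQ, hsum⟩ :=
    Submodule.mem_sup.1 (show F ∈ _ ⊔ _ from hc.sup_eq_top ▸ Submodule.mem_top)
  -- Dropping the `ker D_A` component of `P₀` leaves `D_A P₀` unchanged and normalizes `P` to lie in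
  -- `range D_{Aᵀ}`.
  obtain ⟨P, hP, N, hN, rfl⟩ :=
    Submodule.mem_sup.1 (show P₀ ∈ _ ⊔ _ from hc'.sup_eq_top ▸ Submodule.mem_top)
  rw [map_add, LinearMap.mem_ker.1 hN, add_zero] at hsum
  -- The defect of semi-invariance of `D_A P` lies in `range D_A`; as `F` has no defect, it is also
  -- minus the defect of `Q`, which lies in `ker D_{Aᵀ}`.
  have hzero : ∀ g, substOp (ρ g : V →L[ℝ] V) k (vfDeriv A k P) -
      (((σ₁ * σ₂) g : ℤ) : ℝ) • vfDeriv A k P = 0 := by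
    intro g
    refine Submodule.disjoint_def.1 hc.disjoint _ ?_ ?_
    · rw [substOp_vfDeriv (hA g)]
      exact sub_mem (Submodule.smul_mem _ _ ⟨_, rfl⟩) (Submodule.smul_mem _ _ ⟨_, rfl⟩)
    · have h := mem_semiInvariants_iff.1 hF g
      rw [← hsum, map_add, smul_add] at h
      have e : substOp (ρ g : V →L[ℝ] V) k (vfDeriv A k P) -
          (((σ₁ * σ₂) g : ℤ) : ℝ) • vfDeriv A k P =
          (((σ₁ * σ₂) g : ℤ) : ℝ) • Q - substOp (ρ g : V →L[ℝ] V) k Q := by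
        rw [sub_eq_sub_iff_add_eq_add, h, add_comm]
      rw [e]
      refine sub_mem (Submodule.smul_mem _ _ hQ) ?_
      have h0 := substOp_vfDeriv (hA' g) Q
      rw [LinearMap.mem_ker.1 hQ, map_zero] at h0
      rw [LinearMap.mem_ker, ← one_smul ℝ (vfDeriv _ k _), ← intCast_units_mul_self (σ₂ g),
        mul_smul, ← h0, smul_zero]
  have hDP : vfDeriv A k P ∈ semiInvariants ρ (σ₁ * σ₂) k :=
    mem_semiInvariants_iff.2 fun g => sub_eq_zero.1 (hzero g)
  refine ⟨P, mem_semiInvariants_iff.2 fun g => sub_eq_zero.1 ?_, Q, hQ, ?_, hsum⟩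
  -- The defect of `P` stays in `range D_{Aᵀ}` by the normalization, and `D_A` kills it because `D_A
  -- P` has none.
  · refine Submodule.disjoint_def.1 hc'.disjoint _ ?_ ?_
    · refine sub_mem ?_ (Submodule.smul_mem _ _ hP)
      obtain ⟨P', rfl⟩ := hP
      rw [substOp_vfDeriv (hA' g)]
      exact Submodule.smul_mem _ _ ⟨_, rfl⟩
    · have h := sub_eq_zero.1 (hzero g)
      rw [substOp_vfDeriv (hA g)] at h
      -- Multiplying by `σ₂(g)`, whose square is `1`, turns the character `σ₁σ₂` into `σ₁`.
      have h' := congrArg (fun R => ((σ₂ g : ℤ) : ℝ) • R) h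
      simp only [smul_smul, intCast_units_mul_self, one_smul] at h'
      rw [LinearMap.mem_ker, map_sub, map_smul, h', sub_eq_zero]
      congr 1
      rw [MonoidHom.mul_apply, Units.val_mul, Int.cast_mul, mul_left_comm,
        intCast_units_mul_self, mul_one]
  · rw [← eq_sub_iff_add_eq'] at hsum
    rw [hsum]
    exact sub_mem hF hDP

end

end HamiltonianNormalForm

theorem mainTheorem2
    {V : Type*} [NormedAddCommGroup V] [InnerProductSpace ℝ V] [FiniteDimensional ℝ V]
    (ω : LinearMap.BilinForm ℝ V) (hω_alt : ω.IsAlt) (hω : ω.Nondegenerate)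
    {E : Type*} [NormedAddCommGroup E] [NormedSpace ℝ E] [FiniteDimensional ℝ E]
    {Γ : Type*} [Group Γ] [TopologicalSpace Γ] [ChartedSpace E Γ]
    [LieGroup (modelWithCornersSelf ℝ E) ((⊤ : ℕ∞) : WithTop ℕ∞) Γ] [CompactSpace Γ]
    (ρ : Γ →* (V →L[ℝ] V)ˣ)
    (hρ : Continuous fun p : Γ × V => (ρ p.1 : V →L[ℝ] V) p.2)
    (σ₁ σ₂ : Γ →* ℤˣ) (hsemi : IsSemisymplectic ω ρ σ₁)
    (H : V → ℝ) (hH : ContDiff ℝ ((⊤ : ℕ∞) : WithTop ℕ∞) H) (hH0 : H 0 = 0)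
    (hX0 : hamVF ω hω H 0 = 0)
    (hequiv : ∀ (γ : Γ) (x : V), hamVF ω hω H ((ρ γ : V →L[ℝ] V) x) =
      ((σ₂ γ : ℤ) : ℝ) • (ρ γ : V →L[ℝ] V) (hamVF ω hω H x))
    (L : V →L[ℝ] V) (hL : L = fderiv ℝ (hamVF ω hω H) 0)
    (hcompat : SemidirectCompatible ρ σ₂ L)
    (hS : IsSemisymplectic ω (groupS L).subtype 1)
    (k : ℕ) (hk : 3 ≤ k) :
    Disjoint
        (Submodule.map (adOp ω hω (quadraticPart H) k) (semiInvariants ρ σ₁ k))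
        (semiInvariants (semidirectAction ρ σ₂ L hcompat)
          (tildeHom σ₂ L σ₁ * tildeHom σ₂ L σ₂) k) ∧
      Submodule.map (adOp ω hω (quadraticPart H) k) (semiInvariants ρ σ₁ k) ⊔
        semiInvariants (semidirectAction ρ σ₂ L hcompat)
          (tildeHom σ₂ L σ₁ * tildeHom σ₂ L σ₂) k =
      semiInvariants ρ (σ₁ * σ₂) k := by
  subst hL
  have hH2 : ContDiff ℝ 2 H := contDiff_infty.1 hH 2
  have hA := fun γ => fderiv_zero_equivariant (hasFDerivAt_hamVF ω hω hH2 0).1 (hequiv γ)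
  rw [adOp_quadraticPart ω hω hH2]
  refine ⟨?_, le_antisymm (sup_le (map_vfDeriv_semiInvariants_le hA k) fun F hF =>
    ((mem_semiInvariants_semidirectAction_iff hcompat σ₁ σ₂).1 hF).2) fun F hF => ?_⟩
  -- Directness is inherited from the splitting of all of `𝒫ᵏ`; only the spanning half needs
  -- equivariance.
  · exact (disjoint_range_ker_vfDeriv_adjoint _ k).mono LinearMap.map_le_range fun F hF =>
      ((mem_semiInvariants_semidirectAction_iff hcompat σ₁ σ₂).1 hF).1
  · obtain ⟨P, hP, Q, hQ, hQ', rfl⟩ :=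
      exists_semiInvariant_decomposition hA hcompat.transp_apply hF
    exact Submodule.add_mem_sup (Submodule.mem_map_of_mem hP)
      ((mem_semiInvariants_semidirectAction_iff hcompat σ₁ σ₂).2 ⟨hQ, hQ'⟩)
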